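/- Let $\mathcal H$ be a finite simple hypergraph with vertex set $V$ (edges are subsets of $V$, and no edge contains another). A set of vertices is independent if it contains no edge, and $\Delta_{\mathcal H}$ is the simplicial complex of independent sets. A *bouquet* of $\mathcal H$ is a nonempty set of edges of $\mathcal H$, its *stems*, whose intersection is nonempty, together with a set of *roots*: if there are at least two stems, the roots are all elements of their intersection; if $E$ is the only stem, the roots are a chosen proper subset of $E$, nonempty unless $|E|=1$. The *flowers* are the vertices of the stems that are not roots. A set of bouquets $\mathcal B=\{B_1,\dots,B_n\}$ consists of bouquets with pairwise different sets of stems (different bouquets may share vertices and stems); $F(\mathcal B)$, $R(\mathcal B)$, $S(\mathcal B)$ denote the sets of all flowers, roots, stems of its members. An *induced matching* is a set $\{E_1,\dots,E_k\}$ of pairwise disjoint edges such that no other edge is contained in $E_1\cup\dots\cup E_k$. The set $\mathcal B$ is *strongly disjoint* if one can choose a stem $E_i$ of each $B_i$ such that $E_1,\dots,E_n$ are distinct and $\{E_1,\dots,E_n\}$ is an induced matching, and *semi-strongly disjoint* if $R(\mathcal B)$ is independent. Let $$c_{\mathcal H}=\max\Big\{\Big|\bigcup_{i=1}^k E_i\Big|-k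 : \{E_1,\dots,E_k\}\text{ an induced matching}\Big\},$$ and let $d_{\mathcal H}$ (resp. $d'_{\mathcal H}$) be the maximum of $|F(\mathcal B)|$ over all strongly disjoint (resp. semi-strongly disjoint) sets of bouquets $\mathcal B$ of $\mathcal H$. Let $k$ be a field, $R=k[x_v : v\in V]$, and let $I(\mathcal H)=\big(\prod_{v\in E}x_v : E \text{ an edge}\big)$ be the edge ideal. Write $\operatorname{bigheight} I(\mathcal H)$ for the largest height of a minimal prime of $I(\mathcal H)$, and $\operatorname{pd}$ for projective dimension over $R$. A simplicial complex $\Delta$ on a finite vertex set $W$ (whose elements need not be faces) is *vertex decomposable* if its only facet is $W$, or it has no faces at all, or there is $x\in W$ such that the deletion $\{F\in\Delta: x\notin F\}$ and the link $\{F: x\notin F,\ F\cup\{x\}\in\Delta\}$, as complexes on $W\setminus\{x\}$, are vertex decomposable and every facet of the deletion is a facet of $\Delta$. The hypergraph $\mathcal H$ is vertex decomposable if $\Delta_{\mathcal H}$, on the vertex set $V$, is. **Theorem.** Let $\mathcal B$ be a semi-strongly disjoint set of bouquets of $\mathcal H$ with $|F(\mathcal B)|=d'_{\mathcal H}$. (i)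 There is a minimal vertex cover of $\mathcal H$ contained in $F(\mathcal B)$. (ii) If all edges in $S(\mathcal B)$ have cardinality two (in particular, if $\mathcal H$ is a graph), then $F(\mathcal B)$ is a minimal vertex cover of $\mathcal H$, and $$c_{\mathcal H}\le d_{\mathcal H}\le d'_{\mathcal H}\le \operatorname{bigheight} I(\mathcal H)\le \operatorname{pd}(R/I(\mathcal H)).$$ (iii) If $\mathcal H$ is vertex decomposable and all edges in $S(\mathcal B)$ have cardinality two (in particular, if $\mathcal H$ is a vertex decomposable graph), then $$\operatorname{bigheight} I(\mathcal H)=\operatorname{pd}(R/I(\mathcal H))=d'_{\mathcal H}.$$ -/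

import Mathlib

universe u w

/-- A simplicial complex as a downward closed family of finite sets. Both the complex without any
face (the empty complex `∅`) and the complex `{∅}` are allowed, and a point of `V` need not be a
face. -/
structure FaceComplex (V : Type u) where
  faces : Set (Finset V)
  down_closed : ∀ ⦃F G : Finset V⦄, F ∈ faces → G ⊆ F → G ∈ faces

namespace FaceComplex

variable {V : Type u}

/-- The facets are the inclusion-maximal faces. -/
def IsFacet (Δ : FaceComplex V) (F : Finset V) : Prop :=
  Maximal (fun G => G ∈ Δ.faces) F

/-- The deletion of `x`: the faces that avoid `x`. -/
def del (Δ : FaceComplex V) (x : V) : FaceComplex V where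
  faces := {F | F ∈ Δ.faces ∧ x ∉ F}
  down_closed := fun _ _ hF hG => ⟨Δ.down_closed hF.1 hG, fun hx => hF.2 (hG hx)⟩

/-- The link of `x`: the sets `F` with `x ∉ F` and `F ∪ {x}` a face. -/
def link [DecidableEq V] (Δ : FaceComplex V) (x : V) : FaceComplex V where
  faces := {F | x ∉ F ∧ insert x F ∈ Δ.faces}
  down_closed := fun _ _ hF hG =>
    ⟨fun hx => hF.1 (hG hx), Δ.down_closed hF.2 (Finset.insert_subset_insert x hG)⟩

/-- `VertexDecomposable W Δ`: the complex `Δ` on the finite vertex set `W` is vertex decomposable.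
The deletion and the link of `x` are complexes on the vertex set `W \ {x}`. -/
inductive VertexDecomposable [DecidableEq V] : Finset V → FaceComplex V → Prop
  | simplex (W : Finset V) (Δ : FaceComplex V) (h : ∀ F, Δ.IsFacet F ↔ F = W) :
      VertexDecomposable W Δ
  | void (W : Finset V) (Δ : FaceComplex V) (h : Δ.faces = ∅) : VertexDecomposable W Δ
  | shed (W : Finset V) (Δ : FaceComplex V) (x : V) (hx : x ∈ W)
      (hdel : VertexDecomposable (W.erase x) (Δ.del x))
      (hlink : VertexDecomposable (W.erase x) (Δ.link x))
      (hfacet : ∀ F, (Δ.del x).IsFacet F → Δ.IsFacet F) : VertexDecomposable W Δ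

end FaceComplex

/-- A finite simple hypergraph whose vertex set is the (finite) type `V`: no edge contains another
one. Edges with one element are allowed. -/
structure SimpleHypergraph (V : Type u) where
  edges : Finset (Finset V)
  antichain : ∀ E ∈ edges, ∀ E' ∈ edges, E ⊆ E' → E = E'

namespace SimpleHypergraph

variable {V : Type u}

/-- A set of vertices is independent if it contains no edge. -/
def IsIndependent (H : SimpleHypergraph V) (S : Finset V) : Prop :=
  ∀ E ∈ H.edges, ¬ E ⊆ S

/-- The independence complex of `H`: its faces are the independent sets. -/
def independenceComplex (H : SimpleHypergraph V) : FaceComplex V where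
  faces := {S | H.IsIndependent S}
  down_closed := fun _ _ hF hG E hE hEG => hF E hE (hEG.trans hG)

/-- `H` is vertex decomposable if its independence complex, on the vertex set of `H`, is. -/
def IsVertexDecomposable [Fintype V] [DecidableEq V] (H : SimpleHypergraph V) : Prop :=
  FaceComplex.VertexDecomposable Finset.univ H.independenceComplex

/-- A vertex cover meets every edge. -/
def IsVertexCover (H : SimpleHypergraph V) (C : Finset V) : Prop :=
  ∀ E ∈ H.edges, ∃ v ∈ E, v ∈ C

/-- A vertex cover that is minimal with respect to inclusion. -/
def IsMinimalVertexCover (H : SimpleHypergraph V) (C : Finset V) : Prop :=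
  Minimal H.IsVertexCover C

/-- An induced matching: a set of pairwise disjoint edges such that the only edges contained in
its union are its members. -/
def IsInducedMatching [DecidableEq V] (H : SimpleHypergraph V) (M : Finset (Finset V)) : Prop :=
  M ⊆ H.edges ∧ (∀ E ∈ H.edges, E ⊆ M.biUnion id → E ∈ M) ∧
    ∀ E ∈ M, ∀ E' ∈ M, E ≠ E' → Disjoint E E'

/-- The induced matching number `c_H`, the maximum of `|E₁ ∪ ⋯ ∪ E_k| - k` over the induced
matchings `{E₁, …, E_k}`. The subtraction is not truncated when the edges are nonempty. -/
noncomputable def inducedMatchingNumber [DecidableEq V] (H : SimpleHypergraph V) : ℕ :=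
  sSup {n | ∃ M, H.IsInducedMatching M ∧ n = (M.biUnion id).card - M.card}

/-- A bouquet of `H`: a nonempty set of edges of `H` (its stems) with a common vertex, together
with its set of roots. If there are at least two stems, the roots are all the vertices common to
the stems. If `E` is the only stem, the roots are a chosen proper subset of `E`, which has to be
nonempty whenever `E` has a nonempty proper subset, that is, unless `E` has one element. -/
structure Bouquet (H : SimpleHypergraph V) where
  stems : Finset (Finset V)
  roots : Finset V
  stems_subset : stems ⊆ H.edges
  stems_nonempty : stems.Nonempty
  exists_common : ∃ x, ∀ E ∈ stems, x ∈ E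
  roots_of_two_le : 2 ≤ stems.card → ∀ v, v ∈ roots ↔ ∀ E ∈ stems, v ∈ E
  roots_of_single : ∀ E, stems = {E} → roots ⊂ E ∧ (roots = ∅ → E.card = 1)

/-- The flowers of a bouquet: the vertices of its stems that are not roots. -/
def Bouquet.flowers [DecidableEq V] {H : SimpleHypergraph V} (B : H.Bouquet) : Finset V :=
  B.stems.biUnion fun E => E \ B.roots

/-- A set of bouquets of `H`. Distinct members are distinct as hypergraphs, so every bouquet in
the set carries one choice of roots. Different bouquets may share vertices and stems. -/
structure BouquetSet (H : SimpleHypergraph V) where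
  carrier : Finset H.Bouquet
  injOn_stems : Set.InjOn Bouquet.stems (carrier : Set H.Bouquet)

namespace BouquetSet

variable [DecidableEq V] {H : SimpleHypergraph V}

/-- `F(𝓑)`: the flowers of the bouquets in `𝓑`. -/
def flowers (𝓑 : H.BouquetSet) : Finset V := 𝓑.carrier.biUnion fun B => B.flowers

/-- `R(𝓑)`: the roots of the bouquets in `𝓑`. -/
def roots (𝓑 : H.BouquetSet) : Finset V := 𝓑.carrier.biUnion fun B => B.roots

/-- `S(𝓑)`: the stems of the bouquets in `𝓑`. -/
def stems (𝓑 : H.BouquetSet) : Finset (Finset V) := 𝓑.carrier.biUnion fun B => B.stems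

/-- `𝓑 = {B₁, …, B_n}` is strongly disjoint if one can choose a stem `E_i` of each `B_i` such that
the `n` edges `E₁, …, E_n` are distinct and form an induced matching. -/
def IsStronglyDisjoint (𝓑 : H.BouquetSet) : Prop :=
  ∃ e : H.Bouquet → Finset V, (∀ B ∈ 𝓑.carrier, e B ∈ B.stems) ∧
    Set.InjOn e (𝓑.carrier : Set H.Bouquet) ∧ H.IsInducedMatching (𝓑.carrier.image e)

/-- `𝓑` is semi-strongly disjoint if `R(𝓑)` is independent. -/
def IsSemiStronglyDisjoint (𝓑 : H.BouquetSet) : Prop :=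
  H.IsIndependent 𝓑.roots

end BouquetSet

/-- `d_H`, the maximum of `|F(𝓑)|` over the strongly disjoint sets of bouquets of `H`. -/
noncomputable def dNumber [DecidableEq V] (H : SimpleHypergraph V) : ℕ :=
  sSup {n | ∃ 𝓑 : H.BouquetSet, 𝓑.IsStronglyDisjoint ∧ n = 𝓑.flowers.card}

/-- `d'_H`, the maximum of `|F(𝓑)|` over the semi-strongly disjoint sets of bouquets of `H`. -/
noncomputable def dNumber' [DecidableEq V] (H : SimpleHypergraph V) : ℕ :=
  sSup {n | ∃ 𝓑 : H.BouquetSet, 𝓑.IsSemiStronglyDisjoint ∧ n = 𝓑.flowers.card}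

/-- The edge ideal `I(H)`, generated by the monomials `∏_{x ∈ E} X_x` for the edges `E`. -/
noncomputable def edgeIdeal (k : Type w) [Field k] (H : SimpleHypergraph V) :
    Ideal (MvPolynomial V k) :=
  Ideal.span {f | ∃ E ∈ H.edges, f = ∏ x ∈ E, MvPolynomial.X x}

end SimpleHypergraph

/-- The big height of an ideal: the largest height of a minimal prime over it. -/
noncomputable def Ideal.bigheight {R : Type u} [CommRing R] (I : Ideal R) : ℕ∞ :=
  ⨆ p ∈ I.minimalPrimes, p.height

/-! The combinatorial core compares `d'` with minimal vertex covers. In a minimal cover `C` every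
vertex `v` has a private edge, one meeting `C` only in `v`. All such edges, with their vertices off
`C` as roots, form a semi-strongly disjoint set whose flowers contain `C`, so `|C| ≤ d'`
(`IsMinimalVertexCover.card_le_dNumber'`). Conversely, the flowers of a maximal `𝓑` cover `H`, since
a missed edge would yield one more flower (`isVertexCover_flowers`). If all stems have two elements,
each flower is joined to a root, and independence of the roots makes this cover minimal.

Minimal primes of the edge ideal are generated by the variables of minimal covers `C` and have
height `|C|`, so the big height is `d'` in that case. The projective dimension is at least `|C|`
because some `Ext` of degree `|C|` is nonzero, with values in a copy of `k` on which the variables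
in `C` act as `0` and the others as `1`. For the upper bound, the sequence `0 → R/(I : x) → R/I →
R/(I + (x)) → 0` translates star and deletion into algebra, and induction along shedding vertices
bounds the dimension by the largest complement of a facet, which is a minimal cover. -/

section StanleyReisner

open CategoryTheory Abelian

/-! ### The colon sequence, projective dimension and `Ext` -/

section CommAlg

variable {R : Type u} [CommRing R]

/-- Multiplication by `x`, as a map `R ⧸ J → R ⧸ I` where `J = (I : x)`. -/
def Ideal.quotientMulOfColon (I J : Ideal R) (x : R) (h : ∀ f, x * f ∈ I ↔ f ∈ J) :
    (R ⧸ J) →ₗ[R] (R ⧸ I) :=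
  Submodule.mapQ J I (LinearMap.lsmul R R x)
    (show J ≤ Submodule.comap (LinearMap.lsmul R R x) I from fun f hf => (h f).2 hf)

theorem Ideal.quotientMulOfColon_mk (I J : Ideal R) (x : R)
    (h : ∀ f, x * f ∈ I ↔ f ∈ J) (f : R) :
    I.quotientMulOfColon J x h (Submodule.Quotient.mk f) = Submodule.Quotient.mk (x * f) :=
  rfl

theorem Ideal.quotientMulOfColon_injective (I J : Ideal R) (x : R)
    (h : ∀ f, x * f ∈ I ↔ f ∈ J) : Function.Injective (I.quotientMulOfColon J x h) := by
  rw [injective_iff_map_eq_zero]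
  intro a ha
  obtain ⟨f, rfl⟩ := Submodule.Quotient.mk_surjective J a
  rw [Ideal.quotientMulOfColon_mk, Submodule.Quotient.mk_eq_zero] at ha
  exact (Submodule.Quotient.mk_eq_zero J).2 ((h f).1 ha)

theorem Ideal.exact_quotientMulOfColon_factor (I J : Ideal R) (x : R)
    (h : ∀ f, x * f ∈ I ↔ f ∈ J) {K : Ideal R} (hK : I ⊔ Ideal.span {x} = K) (hIK : I ≤ K) :
    Function.Exact (I.quotientMulOfColon J x h) (Submodule.factor hIK) := by
  intro b
  obtain ⟨f, rfl⟩ := Submodule.Quotient.mk_surjective I b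
  change Submodule.Quotient.mk f = 0 ↔ _
  rw [Submodule.Quotient.mk_eq_zero, ← hK]
  constructor
  · intro hf
    obtain ⟨i, hi, j, hj, rfl⟩ := Submodule.mem_sup.1 hf
    obtain ⟨g, rfl⟩ := Ideal.mem_span_singleton'.1 hj
    refine ⟨Submodule.Quotient.mk g, ?_⟩
    rw [Ideal.quotientMulOfColon_mk, Submodule.Quotient.eq]
    have : x * g - (i + g * x) = -i := by ring
    simpa [this] using hi
  · rintro ⟨a, ha⟩
    obtain ⟨g, rfl⟩ := Submodule.Quotient.mk_surjective J a
    rw [Ideal.quotientMulOfColon_mk, Submodule.Quotient.eq] at ha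
    have h2 : x * g ∈ Ideal.span {x} := Ideal.mul_mem_right _ _ (Ideal.mem_span_singleton_self x)
    have := Submodule.sub_mem (I ⊔ Ideal.span {x}) (Submodule.mem_sup_right h2)
      (Submodule.mem_sup_left ha)
    simpa using this

/-- The short complex `R ⧸ (I : x) → R ⧸ I → R ⧸ (I + (x))`. -/
abbrev Ideal.colonShortComplex (I J K : Ideal R) (x : R) (h : ∀ f, x * f ∈ I ↔ f ∈ J)
    (hK : I ⊔ Ideal.span {x} = K) : ShortComplex (ModuleCat.{u} R) :=
  ModuleCat.shortComplexOfCompEqZero (I.quotientMulOfColon J x h)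
    (Submodule.factor (hK ▸ le_sup_left : I ≤ K))
    (I.exact_quotientMulOfColon_factor J x h hK (hK ▸ le_sup_left)).linearMap_comp_eq_zero

theorem Ideal.colonShortComplex_shortExact (I J K : Ideal R) (x : R)
    (h : ∀ f, x * f ∈ I ↔ f ∈ J) (hK : I ⊔ Ideal.span {x} = K) :
    (I.colonShortComplex J K x h hK).ShortExact where
  exact := ModuleCat.shortComplex_exact _ (I.exact_quotientMulOfColon_factor J x h hK
    (hK ▸ le_sup_left))
  mono_f := (ModuleCat.mono_iff_injective _).2 (I.quotientMulOfColon_injective J x h)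
  epi_g := (ModuleCat.epi_iff_surjective _).2 (Submodule.factor_surjective (hK ▸ le_sup_left))

theorem Ideal.hasProjectiveDimensionLT_of_colon {I J K : Ideal R} {x : R}
    (h : ∀ f, x * f ∈ I ↔ f ∈ J) (hK : I ⊔ Ideal.span {x} = K) {n : ℕ}
    (h₁ : HasProjectiveDimensionLT (ModuleCat.of R (R ⧸ J)) n)
    (h₃ : HasProjectiveDimensionLT (ModuleCat.of R (R ⧸ K)) n) :
    HasProjectiveDimensionLT (ModuleCat.of R (R ⧸ I)) n :=
  (I.colonShortComplex_shortExact J K x h hK).hasProjectiveDimensionLT_X₂ n h₁ h₃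

theorem Ideal.hasProjectiveDimensionLT_succ_of_colon {I K : Ideal R} {x : R}
    (h : ∀ f, x * f ∈ I ↔ f ∈ I) (hK : I ⊔ Ideal.span {x} = K) {n : ℕ}
    (hI : HasProjectiveDimensionLT (ModuleCat.of R (R ⧸ I)) n) :
    HasProjectiveDimensionLT (ModuleCat.of R (R ⧸ K)) (n + 1) :=
  (I.colonShortComplex_shortExact I K x h hK).hasProjectiveDimensionLT_X₃ n hI
    (hasProjectiveDimensionLT_of_ge _ n (n + 1) n.le_succ)

/-- If `x` is regular on `R ⧸ I` and kills `N`, then the connecting map from the `Ext` of `R ⧸ I`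
to that of `R ⧸ (I + (x))` is injective. -/
theorem Ideal.exists_ext_ne_zero_of_smul_eq_zero {I K : Ideal R} {x : R}
    (h : ∀ f, x * f ∈ I ↔ f ∈ I) (hK : I ⊔ Ideal.span {x} = K) {N : ModuleCat.{u} R}
    (hN : x • 𝟙 N = 0) {n : ℕ} (e : Ext (ModuleCat.of R (R ⧸ I)) N n) (he : e ≠ 0) :
    ∃ e' : Ext (ModuleCat.of R (R ⧸ K)) N (n + 1), e' ≠ 0 := by
  have hS := I.colonShortComplex_shortExact I K x h hK
  refine ⟨hS.extClass.comp (Y := ModuleCat.of R (R ⧸ I)) e (add_comm 1 n), fun h0 => he ?_⟩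
  -- By exactness, a class killed by the connecting map is `x` times some `y`; but `x` kills `N`,
  -- hence also `Ext` into `N`.
  obtain ⟨(y : Ext (ModuleCat.of R (R ⧸ I)) N n), hy⟩ :=
    Ext.contravariant_sequence_exact₁ hS N e (add_comm 1 n) h0
  have hy' : (Ext.mk₀ (x • 𝟙 (ModuleCat.of R (R ⧸ I)))).comp y (zero_add n) = e := hy
  rw [← hy', Ext.mk₀_smul, Ext.smul_comp, Ext.mk₀_id_comp, Ext.smul_eq_comp_mk₀, hN,
    Ext.mk₀_zero, Ext.comp_zero]

/-- The action of `x` on `Ext` can be computed through either argument: it is zero through `X` and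
the identity through `N`. -/
theorem CategoryTheory.Abelian.Ext.eq_zero_of_smul {X N : ModuleCat.{u} R} {x : R}
    (hX : x • 𝟙 X = 0) (hN : x • 𝟙 N = 𝟙 N) {n : ℕ} (e : Ext X N n) : e = 0 := by
  have h1 : x • e = e := by rw [Ext.smul_eq_comp_mk₀, hN, Ext.comp_mk₀_id]
  have h2 : x • e = 0 := by
    conv_lhs => rw [← Ext.mk₀_id_comp e, ← Ext.smul_comp, ← Ext.mk₀_smul, hX, Ext.mk₀_zero,
      Ext.zero_comp]
  rw [← h1, h2]

/-- If `x` acts as the identity on `N`, then the `Ext` of `R ⧸ I` maps onto that of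
`R ⧸ (I : x)`. -/
theorem Ideal.exists_ext_ne_zero_of_smul_eq_id {I J : Ideal R} {x : R}
    (h : ∀ f, x * f ∈ I ↔ f ∈ J) {N : ModuleCat.{u} R}
    (hN : x • 𝟙 N = 𝟙 N) {n : ℕ} (e : Ext (ModuleCat.of R (R ⧸ J)) N n) (he : e ≠ 0) :
    ∃ e' : Ext (ModuleCat.of R (R ⧸ I)) N n, e' ≠ 0 := by
  have hS := I.colonShortComplex_shortExact J _ x h rfl
  have hX : x • 𝟙 (ModuleCat.of R (R ⧸ (I ⊔ Ideal.span {x}))) = 0 := by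
    refine ModuleCat.hom_ext (LinearMap.ext fun a => ?_)
    obtain ⟨f, rfl⟩ := Submodule.Quotient.mk_surjective _ a
    change Submodule.Quotient.mk (x • f) = 0
    rw [Submodule.Quotient.mk_eq_zero]
    exact Submodule.mem_sup_right
      (Ideal.mul_mem_right _ _ (Ideal.mem_span_singleton_self x))
  obtain ⟨(y : Ext (ModuleCat.of R (R ⧸ I)) N n), hy⟩ :=
    Ext.contravariant_sequence_exact₁ hS N e (add_comm 1 n)
      (Ext.eq_zero_of_smul hX hN _)
  refine ⟨y, ?_⟩
  rintro rfl
  exact he (hy.symm.trans (Ext.comp_zero ..))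

end CommAlg

/-! ### Stanley-Reisner ideals: colon and sum with a variable -/

namespace FaceComplex

variable {V : Type u}

@[ext]
theorem ext_faces {Δ Γ : FaceComplex V} (h : ∀ F, F ∈ Δ.faces ↔ F ∈ Γ.faces) : Δ = Γ := by
  cases Δ; cases Γ
  congr
  exact Set.ext h

/-- The star of `x`: the sets `F` with `F ∪ {x}` a face. -/
def star [DecidableEq V] (Δ : FaceComplex V) (x : V) : FaceComplex V where
  faces := {F | insert x F ∈ Δ.faces}
  down_closed := fun _ _ hF hG => Δ.down_closed hF (Finset.insert_subset_insert x hG)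

/-- The sets whose trace on `W` is a face. -/
def extend [DecidableEq V] (Δ : FaceComplex V) (W : Finset V) : FaceComplex V where
  faces := {F | F ∩ W ∈ Δ.faces}
  down_closed := fun _ _ hF hG => Δ.down_closed hF (Finset.inter_subset_inter_right hG)

/-- The simplex of the finite sets that avoid `S`. -/
def avoiding (S : Finset V) : FaceComplex V where
  faces := {F | Disjoint F S}
  down_closed := fun _ _ hF hG => Disjoint.mono_left hG hF

variable (k : Type w) [Field k]

/-- The Stanley-Reisner ideal, spanned by the monomials whose support is not a face. -/
noncomputable def nonfaceIdeal (Δ : FaceComplex V) : Ideal (MvPolynomial V k) :=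
  MvPolynomial.restrictSupportIdeal k {m | m.support ∉ Δ.faces}
    fun _ _ hmn hm hn => hm (Δ.down_closed hn (Finsupp.support_mono hmn))

variable {k}

theorem mem_nonfaceIdeal {Δ : FaceComplex V} {f : MvPolynomial V k} :
    f ∈ Δ.nonfaceIdeal k ↔ ∀ m ∈ f.support, m.support ∉ Δ.faces :=
  Iff.rfl

theorem nonfaceIdeal_of_faces_eq_empty {Δ : FaceComplex V} (h : Δ.faces = ∅) :
    Δ.nonfaceIdeal k = ⊤ := by
  rw [eq_top_iff]
  intro f _ m _
  simp [h]

variable [DecidableEq V]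

/-- Membership depends only on supports of monomials, and multiplying by `X x` inserts `x` into each
support. -/
theorem X_mul_mem_nonfaceIdeal_iff (Δ : FaceComplex V) (x : V) (f : MvPolynomial V k) :
    MvPolynomial.X x * f ∈ Δ.nonfaceIdeal k ↔ f ∈ (Δ.star x).nonfaceIdeal k := by
  have key : ∀ m : V →₀ ℕ, (Finsupp.single x 1 + m).support = insert x m.support := by
    intro m; ext y
    by_cases h : x = y <;> simp [h]
    grind
  rw [mem_nonfaceIdeal, mem_nonfaceIdeal, MvPolynomial.support_X_mul]
  simp [star, key]

theorem nonfaceIdeal_sup_span_X (Δ : FaceComplex V) (x : V) :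
    Δ.nonfaceIdeal k ⊔ Ideal.span {MvPolynomial.X x} = (Δ.del x).nonfaceIdeal k := by
  apply le_antisymm
  · refine sup_le (fun f hf => mem_nonfaceIdeal.2 fun m hm h => mem_nonfaceIdeal.1 hf m hm h.1) ?_
    rw [Ideal.span_singleton_le_iff_mem, mem_nonfaceIdeal]
    intro m hm h
    rw [MvPolynomial.support_X, Finset.mem_singleton] at hm
    subst hm
    exact h.2 (by simp)
  · intro f hf
    rw [f.as_sum]
    refine Ideal.sum_mem _ fun m hm => ?_
    by_cases hx : x ∈ m.support
    · refine Submodule.mem_sup_right (Ideal.mem_span_singleton.2 ?_)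
      rw [MvPolynomial.X, MvPolynomial.monomial_dvd_monomial]
      refine ⟨Or.inr ?_, one_dvd _⟩
      simpa [Nat.one_le_iff_ne_zero] using hx
    · refine Submodule.mem_sup_left (mem_nonfaceIdeal.2 fun m' hm' h => ?_)
      obtain rfl := Finset.mem_singleton.1 (MvPolynomial.support_monomial_subset hm')
      exact mem_nonfaceIdeal.1 hf _ hm ⟨h, hx⟩

end FaceComplex

/-! ### Upper bound for vertex decomposable complexes -/

namespace FaceComplex

variable {V : Type u} (k : Type w) [Field k]

theorem exists_isFacet_superset (Δ : FaceComplex V) {W F : Finset V}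
    (hW : ∀ F ∈ Δ.faces, F ⊆ W) (h : F ∈ Δ.faces) : ∃ G, F ⊆ G ∧ Δ.IsFacet G := by
  have hfin : Δ.faces.Finite := W.powerset.finite_toSet.subset fun F hF => by
    simpa using hW F hF
  exact hfin.exists_le_maximal h

theorem hasProjectiveDimensionLT_of_faces_eq_empty {Δ : FaceComplex V} (h : Δ.faces = ∅) (n : ℕ) :
    HasProjectiveDimensionLT
      (ModuleCat.of (MvPolynomial V k) (MvPolynomial V k ⧸ Δ.nonfaceIdeal k)) n := by
  have : Subsingleton (MvPolynomial V k ⧸ Δ.nonfaceIdeal k) := by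
    rw [nonfaceIdeal_of_faces_eq_empty h]
    infer_instance
  have := (ModuleCat.isZero_of_subsingleton (ModuleCat.of (MvPolynomial V k)
    (MvPolynomial V k ⧸ Δ.nonfaceIdeal k))).hasProjectiveDimensionLT_zero
  exact hasProjectiveDimensionLT_of_ge _ 0 n n.zero_le

theorem nonfaceIdeal_eq_bot {Δ : FaceComplex V} (h : ∀ F, F ∈ Δ.faces) :
    Δ.nonfaceIdeal k = ⊥ := by
  rw [eq_bot_iff]
  intro f hf
  rw [Ideal.mem_bot, ← MvPolynomial.support_eq_empty, Finset.eq_empty_iff_forall_notMem]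
  exact fun m hm => mem_nonfaceIdeal.1 hf m hm (h _)

variable [DecidableEq V]

/-- The polynomial ring stays fixed during the induction, so vertices that have left `W` are kept as
cone points by `extend`. -/
theorem star_extend (Δ : FaceComplex V) {W : Finset V} {x : V} (hx : x ∈ W) :
    (Δ.extend W).star x = (Δ.link x).extend (W.erase x) := by
  ext F
  have : insert x F ∩ W = insert x (F ∩ W.erase x) := by grind
  simp [star, extend, link, this]

/-- Extending from `W.erase x` makes `x` a cone point, so the outer deletion is needed again.
Algebraically it adds a regular variable to the ideal. -/
theorem del_extend (Δ : FaceComplex V) (W : Finset V) (x : V) :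
    (Δ.extend W).del x = ((Δ.del x).extend (W.erase x)).del x := by
  ext F
  simp only [del, extend, Set.mem_ofPred_eq]
  by_cases hx : x ∈ F
  · simp [hx]
  · have : F ∩ W.erase x = F ∩ W := by grind
    simp [hx, this]

theorem star_extend_erase (Δ : FaceComplex V) (W : Finset V) (x : V) :
    (Δ.extend (W.erase x)).star x = Δ.extend (W.erase x) := by
  ext F
  simp [star, extend]

theorem isFacet_insert_of_link {Δ : FaceComplex V} {x : V} {F : Finset V}
    (hF : (Δ.link x).IsFacet F) : Δ.IsFacet (insert x F) := by
  refine ⟨hF.prop.2, fun G hG hFG => ?_⟩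
  have hx : x ∈ G := hFG (Finset.mem_insert_self x F)
  have h1 : G.erase x ∈ (Δ.link x).faces :=
    ⟨Finset.notMem_erase x G, by rwa [Finset.insert_erase hx]⟩
  have h2 : F ⊆ G.erase x := Finset.subset_erase.2
    ⟨(Finset.subset_insert x F).trans hFG, hF.prop.1⟩
  have h3 := hF.le_of_ge h1 h2
  intro y hy
  by_cases hyx : y = x
  · exact hyx ▸ Finset.mem_insert_self _ _
  · exact Finset.mem_insert_of_mem (h3 (Finset.mem_erase.2 ⟨hyx, hy⟩))

/-- The Stanley-Reisner ring of a vertex decomposable complex has projective dimension `< n` if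
all the facets have a complement with fewer than `n` elements. -/
theorem VertexDecomposable.hasProjectiveDimensionLT {W : Finset V} {Δ : FaceComplex V}
    (hΔ : VertexDecomposable W Δ) (hW : ∀ F ∈ Δ.faces, F ⊆ W) (n : ℕ)
    (hn : ∀ F, Δ.IsFacet F → (W \ F).card < n) :
    HasProjectiveDimensionLT (ModuleCat.of (MvPolynomial V k)
      (MvPolynomial V k ⧸ (Δ.extend W).nonfaceIdeal k)) n := by
  induction hΔ generalizing n with
  | void W Δ h =>
    exact hasProjectiveDimensionLT_of_faces_eq_empty k (by ext F; simp [extend, h]) n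
  | simplex W Δ h =>
    have hWf : Δ.IsFacet W := (h W).2 rfl
    have hn' := hn W hWf
    have hbot : (Δ.extend W).nonfaceIdeal k = ⊥ :=
      nonfaceIdeal_eq_bot k fun F => Δ.down_closed hWf.prop Finset.inter_subset_right
    rw [hbot]
    have : Projective (ModuleCat.of (MvPolynomial V k)
        (MvPolynomial V k ⧸ (⊥ : Ideal (MvPolynomial V k)))) := by
      have : Module.Projective (MvPolynomial V k)
          (MvPolynomial V k ⧸ (⊥ : Ideal (MvPolynomial V k))) :=
        Module.Projective.of_equiv
          (Submodule.quotEquivOfEqBot (⊥ : Submodule (MvPolynomial V k) (MvPolynomial V k)) rfl).symm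
      exact ModuleCat.projective_of_categoryTheory_projective (R := MvPolynomial V k) _
    exact hasProjectiveDimensionLT_of_ge _ 1 n (by omega)
  | shed W Δ x hx hdel hlink hfacet ihdel ihlink =>
    rcases Δ.faces.eq_empty_or_nonempty with h0 | h0
    · exact hasProjectiveDimensionLT_of_faces_eq_empty k (by ext F; simp [extend, h0]) n
    obtain ⟨F₀, -, hF₀⟩ := Δ.exists_isFacet_superset hW h0.choose_spec
    -- A facet exists, so the strict bound `n` is positive; this leaves room to drop by one for the
    -- deletion.
    obtain ⟨m, rfl⟩ : ∃ m, n = m + 1 := ⟨n - 1, by have := hn F₀ hF₀; omega⟩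
    have h1 := ihlink
      (fun F hF y hy => Finset.mem_erase.2 ⟨fun h => hF.1 (h ▸ hy),
        hW _ hF.2 (Finset.mem_insert_of_mem hy)⟩) (m + 1) (fun F hF => by
        have := hn _ (isFacet_insert_of_link hF)
        rwa [show W.erase x \ F = W \ insert x F by grind])
    -- A facet of the deletion is a facet of `Δ` missing `x`, so its complement in `W.erase x` is
    -- smaller by one. This pays for the step lost when `X x` is added to the ideal.
    have h2 := ihdel
      (fun F hF y hy => Finset.mem_erase.2 ⟨fun h => hF.2 (h ▸ hy), hW _ hF.1 hy⟩) m
      (fun F hF => by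
        have := hn _ (hfacet F hF)
        rw [show W \ F = insert x (W.erase x \ F) by have := hF.prop.2; grind,
          Finset.card_insert_of_notMem (by grind)] at this
        omega)
    have h3 := Ideal.hasProjectiveDimensionLT_succ_of_colon
      (fun f => by rw [X_mul_mem_nonfaceIdeal_iff, star_extend_erase])
      (nonfaceIdeal_sup_span_X ((Δ.del x).extend (W.erase x)) x) h2
    rw [← del_extend] at h3
    rw [← star_extend _ hx] at h1
    exact Ideal.hasProjectiveDimensionLT_of_colon (X_mul_mem_nonfaceIdeal_iff _ x)
      (nonfaceIdeal_sup_span_X _ x) h1 h3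

end FaceComplex

/-! ### Primes generated by variables and the lower bound -/

namespace FaceComplex

variable {V : Type u} (k : Type w) [Field k]

theorem nonfaceIdeal_avoiding (S : Finset V) :
    (avoiding S).nonfaceIdeal k = Ideal.span (MvPolynomial.X '' (S : Set V)) := by
  ext f
  rw [mem_nonfaceIdeal, MvPolynomial.mem_ideal_span_X_image]
  simp [avoiding, Finset.not_disjoint_iff, and_comm]

/-- Setting the variables in `S` to zero does not change classes modulo the ideal, so the ideal is
the kernel of this substitution into a domain. -/
theorem nonfaceIdeal_avoiding_isPrime (S : Finset V) :
    ((avoiding S).nonfaceIdeal k).IsPrime := by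
  classical
  let φ : MvPolynomial V k →ₐ[k] MvPolynomial V k :=
    MvPolynomial.aeval fun v => if v ∈ S then 0 else MvPolynomial.X v
  suffices (avoiding S).nonfaceIdeal k = RingHom.ker φ from this ▸ RingHom.ker_isPrime φ
  rw [nonfaceIdeal_avoiding]
  apply le_antisymm
  · rw [Ideal.span_le]
    rintro _ ⟨v, hv, rfl⟩
    simp [φ, Finset.mem_coe.1 hv]
  · intro f hf
    have h : (Ideal.Quotient.mkₐ k (Ideal.span (MvPolynomial.X '' (S : Set V)))).comp φ =
        Ideal.Quotient.mkₐ k (Ideal.span (MvPolynomial.X '' (S : Set V) :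
          Set (MvPolynomial V k))) := by
      ext v
      by_cases hv : v ∈ S
      · have : (MvPolynomial.X v : MvPolynomial V k) ∈
            Ideal.span (MvPolynomial.X '' (S : Set V)) :=
          Ideal.subset_span ⟨v, hv, rfl⟩
        simp [φ, hv, Ideal.Quotient.eq_zero_iff_mem.2 this]
      · simp [φ, hv]
    have h2 := DFunLike.congr_fun h f
    rw [AlgHom.comp_apply, (RingHom.mem_ker).1 hf, map_zero] at h2
    exact Ideal.Quotient.eq_zero_iff_mem.1 h2.symm

theorem X_mem_nonfaceIdeal_avoiding {S : Finset V} {v : V} :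
    MvPolynomial.X v ∈ (avoiding S).nonfaceIdeal k ↔ v ∈ S := by
  rw [nonfaceIdeal_avoiding, MvPolynomial.mem_ideal_span_X_image, MvPolynomial.support_X]
  simp [Finsupp.single_apply_eq_zero]

theorem le_height_nonfaceIdeal_avoiding (S : Finset V) :
    (S.card : ℕ∞) ≤ ((avoiding S).nonfaceIdeal k).height := by
  classical
  induction S using Finset.induction_on with
  | empty => simp
  | insert v S hv ih =>
    have := nonfaceIdeal_avoiding_isPrime k S
    have := nonfaceIdeal_avoiding_isPrime k (insert v S)
    have hlt : (avoiding S).nonfaceIdeal k < (avoiding (insert v S)).nonfaceIdeal k := by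
      refine lt_of_le_of_ne ?_ fun h => hv ?_
      · rw [nonfaceIdeal_avoiding, nonfaceIdeal_avoiding]
        exact Ideal.span_mono (Set.image_mono (by simp))
      · rw [← X_mem_nonfaceIdeal_avoiding k, h, X_mem_nonfaceIdeal_avoiding]
        exact Finset.mem_insert_self v S
    rw [Finset.card_insert_of_notMem hv, Nat.cast_add, Nat.cast_one]
    exact (add_le_add_left ih 1).trans (Ideal.height_add_one_le_of_lt_of_isPrime hlt)

theorem height_nonfaceIdeal_avoiding [Finite V] (S : Finset V) :
    ((avoiding S).nonfaceIdeal k).height = S.card := by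
  classical
  refine le_antisymm ?_ (le_height_nonfaceIdeal_avoiding k S)
  have := nonfaceIdeal_avoiding_isPrime k S
  have hmem : (avoiding S).nonfaceIdeal k ∈ (Ideal.span ((S.image MvPolynomial.X :
      Finset (MvPolynomial V k)) : Set (MvPolynomial V k))).minimalPrimes := by
    rw [Finset.coe_image, ← nonfaceIdeal_avoiding, Ideal.minimalPrimes_eq_subsingleton_self]
    rfl
  exact (Ideal.height_le_card_of_mem_minimalPrimes_span_finset hmem).trans
    (by exact_mod_cast Finset.card_image_le)

variable {k} [DecidableEq V]

theorem star_avoiding {S : Finset V} {v : V} (hv : v ∉ S) :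
    (avoiding S).star v = avoiding S := by
  ext F
  simp [star, avoiding, hv]

theorem del_avoiding (S : Finset V) (v : V) :
    (avoiding S).del v = avoiding (insert v S) := by
  ext F
  simp [del, avoiding, and_comm]

/-- Start from a nonzero map from the ring to `N`. Each new variable is regular modulo the previous
ones, and its connecting map raises the degree by one injectively. -/
theorem exists_ext_avoiding_ne_zero {N : ModuleCat.{max u w} (MvPolynomial V k)} [Nontrivial N]
    (S : Finset V) (hN : ∀ v ∈ S, (MvPolynomial.X v : MvPolynomial V k) • 𝟙 N = 0) :
    ∃ e : Ext (ModuleCat.of (MvPolynomial V k)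
      (MvPolynomial V k ⧸ (avoiding S).nonfaceIdeal k)) N S.card, e ≠ 0 := by
  induction S using Finset.induction_on with
  | empty =>
    obtain ⟨a, ha⟩ := exists_ne (0 : N)
    have hle : (avoiding (∅ : Finset V)).nonfaceIdeal k ≤
        LinearMap.ker (LinearMap.toSpanSingleton (MvPolynomial V k) N a) := by
      rw [nonfaceIdeal_eq_bot k fun F => by simp [avoiding]]
      exact bot_le
    let φ := ModuleCat.ofHom (Submodule.liftQ _ _ hle)
    rw [Finset.card_empty]
    refine ⟨Ext.mk₀ φ, fun h => ha ?_⟩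
    have h0 : φ = 0 := Ext.homEquiv₀.symm.injective 
      (by simpa only [Ext.homEquiv₀_symm_apply, Ext.mk₀_zero] using h)
    have h1 := congr_arg (fun ψ => ψ.hom (Submodule.Quotient.mk 1)) h0
    have h2 : (1 : MvPolynomial V k) • a = 0 := h1
    rwa [one_smul] at h2
  | insert v S hv ih =>
    obtain ⟨e, he⟩ := ih fun w hw => hN w (Finset.mem_insert_of_mem hw)
    rw [Finset.card_insert_of_notMem hv]
    exact Ideal.exists_ext_ne_zero_of_smul_eq_zero
      (fun f => by rw [X_mul_mem_nonfaceIdeal_iff, star_avoiding hv])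
      (by rw [nonfaceIdeal_sup_span_X, del_avoiding])
      (hN v (Finset.mem_insert_self v S)) e he

/-- `Γ` is the iterated star over `A`, so its ideal is the colon by the product of the variables in
`A`, reached one variable at a time. -/
theorem exists_ext_ne_zero_of_union {N : ModuleCat.{max u w} (MvPolynomial V k)} {n : ℕ}
    (A : Finset V) (hN : ∀ v ∈ A, (MvPolynomial.X v : MvPolynomial V k) • 𝟙 N = 𝟙 N)
    (Δ Γ : FaceComplex V) (hΓ : ∀ F, F ∈ Γ.faces ↔ F ∪ A ∈ Δ.faces)
    (e : Ext (ModuleCat.of (MvPolynomial V k) (MvPolynomial V k ⧸ Γ.nonfaceIdeal k)) N n)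
    (he : e ≠ 0) :
    ∃ e' : Ext (ModuleCat.of (MvPolynomial V k) (MvPolynomial V k ⧸ Δ.nonfaceIdeal k)) N n,
      e' ≠ 0 := by
  induction A using Finset.induction_on generalizing Δ with
  | empty =>
    obtain rfl : Γ = Δ := ext_faces (by simpa using hΓ)
    exact ⟨e, he⟩
  | insert v A hv ih =>
    obtain ⟨e', he'⟩ := ih (fun w hw => hN w (Finset.mem_insert_of_mem hw)) (Δ.star v)
      (fun F => by rw [hΓ, Finset.union_insert]; rfl)
    exact Ideal.exists_ext_ne_zero_of_smul_eq_id (X_mul_mem_nonfaceIdeal_iff Δ v)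
      (hN v (Finset.mem_insert_self v A)) e' he'

/-- If the star of `Cᶜ` is the simplex on `Cᶜ`, then the Stanley-Reisner ring has projective
dimension at least `|C|`. -/
theorem not_hasProjectiveDimensionLT [Fintype V] {Δ : FaceComplex V} {C : Finset V}
    (hC : ∀ F, Disjoint F C ↔ F ∪ Cᶜ ∈ Δ.faces) :
    ¬ HasProjectiveDimensionLT (ModuleCat.of (MvPolynomial V k)
      (MvPolynomial V k ⧸ Δ.nonfaceIdeal k)) C.card := by
  intro hpd
  -- Evaluation at the indicator of `Cᶜ` makes the variables off `C` act invertibly, which replaces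
  -- localization at the prime of `C`.
  let a : V → k := fun v => if v ∈ C then 0 else 1
  let I : Ideal (MvPolynomial V k) := RingHom.ker (MvPolynomial.eval a)
  have : Nontrivial (MvPolynomial V k ⧸ I) :=
    Ideal.Quotient.nontrivial_iff.2 (RingHom.ker_ne_top _)
  let N := ModuleCat.of (MvPolynomial V k) (MvPolynomial V k ⧸ I)
  have : Nontrivial N := this
  obtain ⟨e, he⟩ := exists_ext_avoiding_ne_zero (k := k) (N := N) C fun v hv => by
    refine ModuleCat.hom_ext (LinearMap.ext fun b => ?_)
    obtain ⟨f, rfl⟩ := Submodule.Quotient.mk_surjective _ b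
    change Submodule.Quotient.mk (MvPolynomial.X v • f) = 0
    rw [Submodule.Quotient.mk_eq_zero]
    simp [I, RingHom.mem_ker, a, hv]
  obtain ⟨e', he'⟩ := exists_ext_ne_zero_of_union (k := k) (N := N) Cᶜ (fun v hv => by
    refine ModuleCat.hom_ext (LinearMap.ext fun b => ?_)
    obtain ⟨f, rfl⟩ := Submodule.Quotient.mk_surjective _ b
    change Submodule.Quotient.mk (MvPolynomial.X v • f) = Submodule.Quotient.mk f
    rw [Submodule.Quotient.eq]
    simp [I, RingHom.mem_ker, a, Finset.mem_compl.1 hv]) Δ (avoiding C) hC e he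
  exact he' (e'.eq_zero_of_hasProjectiveDimensionLT C.card le_rfl)

end FaceComplex

/-! ### Minimal covers and bouquets -/

namespace SimpleHypergraph

variable {V : Type u} {H : SimpleHypergraph V}

/-- Otherwise every edge through `v` meets `C` elsewhere and `C.erase v` is still a cover. -/
theorem IsMinimalVertexCover.exists_edge {C : Finset V} (hC : H.IsMinimalVertexCover C)
    {v : V} (hv : v ∈ C) : ∃ E ∈ H.edges, v ∈ E ∧ ∀ w ∈ E, w ∈ C → w = v := by
  classical
  by_contra! h
  refine Finset.notMem_erase v C (hC.le_of_le (fun E hE => ?_) (Finset.erase_subset v C) hv)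
  by_cases hvE : v ∈ E
  · obtain ⟨w, hw, hwC, hwv⟩ := h E hE hvE
    exact ⟨w, hw, Finset.mem_erase.2 ⟨hwv, hwC⟩⟩
  · obtain ⟨w, hw, hwC⟩ := hC.prop E hE
    exact ⟨w, hw, Finset.mem_erase.2 ⟨fun h => hvE (h ▸ hw), hwC⟩⟩

theorem IsVertexCover.isMinimalVertexCover {C : Finset V} (hC : H.IsVertexCover C)
    (h : ∀ v ∈ C, ∃ E ∈ H.edges, ∀ w ∈ E, w ∈ C → w = v) : H.IsMinimalVertexCover C := by
  refine ⟨hC, fun D hD hDC v hv => ?_⟩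
  obtain ⟨E, hE, hEv⟩ := h v hv
  obtain ⟨w, hw, hwD⟩ := hD E hE
  exact hEv w hw (hDC hwD) ▸ hwD

theorem IsVertexCover.exists_isMinimalVertexCover {C : Finset V} (hC : H.IsVertexCover C) :
    ∃ D, H.IsMinimalVertexCover D ∧ D ⊆ C := by
  have hfin : {D | H.IsVertexCover D ∧ D ⊆ C}.Finite :=
    C.powerset.finite_toSet.subset fun D hD => by simpa using hD.2
  obtain ⟨D, hDC, hD⟩ := hfin.exists_le_minimal (a := C) ⟨hC, subset_rfl⟩
  exact ⟨D, ⟨hD.prop.1, fun D' h1 h2 => hD.le_of_le ⟨h1, h2.trans hDC⟩ h2⟩, hDC⟩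

/-- With two stems or more, equality would put one stem inside another, against the antichain
condition. -/
theorem Bouquet.roots_ssubset (B : H.Bouquet) {E : Finset V} (hE : E ∈ B.stems) :
    B.roots ⊂ E := by
  rcases lt_or_ge 1 B.stems.card with h | h
  · have hsub : ∀ E' ∈ B.stems, B.roots ⊆ E' := fun E' hE' v hv =>
      (B.roots_of_two_le h v).1 hv E' hE'
    refine (hsub E hE).ssubset_of_ne fun heq => ?_
    obtain ⟨E', hE', hne⟩ := Finset.exists_mem_ne h E
    exact hne (H.antichain E (B.stems_subset hE) E' (B.stems_subset hE')
      (heq ▸ hsub E' hE')).symm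
  · have h1 : B.stems = {E} := by
      obtain ⟨E', h'⟩ := Finset.card_eq_one.1 (le_antisymm h (Finset.card_pos.2 ⟨E, hE⟩))
      rw [h', Finset.mem_singleton] at hE
      rw [h', hE]
    exact (B.roots_of_single E h1).1

theorem Bouquet.roots_nonempty (B : H.Bouquet) {E : Finset V} (hE : E ∈ B.stems)
    (hcard : E.card ≠ 1) : B.roots.Nonempty := by
  rcases lt_or_ge 1 B.stems.card with h | h
  · obtain ⟨x, hx⟩ := B.exists_common
    exact ⟨x, (B.roots_of_two_le h x).2 hx⟩
  · have h1 : B.stems = {E} := by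
      obtain ⟨E', h'⟩ := Finset.card_eq_one.1 (le_antisymm h (Finset.card_pos.2 ⟨E, hE⟩))
      rw [h', Finset.mem_singleton] at hE
      rw [h', hE]
    exact Finset.nonempty_iff_ne_empty.2 fun h0 => hcard ((B.roots_of_single E h1).2 h0)

variable [DecidableEq V]

theorem isIndependent_compl_iff [Fintype V] {C : Finset V} :
    H.IsIndependent Cᶜ ↔ H.IsVertexCover C := by
  simp only [IsIndependent, IsVertexCover, Finset.subset_iff, Finset.mem_compl]
  push Not
  rfl

theorem isMinimalVertexCover_compl [Fintype V] {F : Finset V}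
    (hF : H.independenceComplex.IsFacet F) : H.IsMinimalVertexCover Fᶜ := by
  refine ⟨isIndependent_compl_iff.1 (by rw [compl_compl]; exact hF.prop), fun D hD hDF => ?_⟩
  have h : Dᶜ ∈ H.independenceComplex.faces := isIndependent_compl_iff.2 hD
  have h2 := hF.le_of_ge h (le_compl_iff_le_compl.1 hDF)
  exact compl_le_iff_compl_le.1 h2

/-- A vertex of `F` in `C` completes its private edge inside `F ∪ Cᶜ`. In ideals: the colon of the
edge ideal by the product of the variables off `C` is the prime of `C`. -/
theorem IsMinimalVertexCover.disjoint_iff [Fintype V] {C : Finset V}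
    (hC : H.IsMinimalVertexCover C) (F : Finset V) :
    Disjoint F C ↔ F ∪ Cᶜ ∈ H.independenceComplex.faces := by
  constructor
  · intro h
    have : F ∪ Cᶜ = Cᶜ := Finset.union_eq_right.2 fun v hv =>
      Finset.mem_compl.2 (Finset.disjoint_left.1 h hv)
    rw [this]
    exact isIndependent_compl_iff.2 hC.prop
  · intro h
    rw [Finset.disjoint_left]
    intro v hv hvC
    obtain ⟨E, hE, hvE, hEv⟩ := hC.exists_edge hvC
    refine h E hE fun w hw => ?_
    by_cases hwC : w ∈ C
    · exact Finset.mem_union_left _ (hEv w hw hwC ▸ hv)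
    · exact Finset.mem_union_right _ (Finset.mem_compl.2 hwC)

/-- The bouquet with the only stem `E`. -/
def Bouquet.single {E r : Finset V} (hE : E ∈ H.edges) (hr : r ⊂ E)
    (hr0 : r = ∅ → E.card = 1) : H.Bouquet where
  stems := {E}
  roots := r
  stems_subset := Finset.singleton_subset_iff.2 hE
  stems_nonempty := Finset.singleton_nonempty E
  exists_common := by
    obtain ⟨x, hx, -⟩ := Finset.exists_of_ssubset hr
    exact ⟨x, by simpa using hx⟩
  roots_of_two_le := by simp
  roots_of_single := by
    intro E' h
    obtain rfl := Finset.singleton_injective h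
    exact ⟨hr, hr0⟩

theorem Bouquet.flowers_single {E r : Finset V} (hE : E ∈ H.edges) (hr : r ⊂ E)
    (hr0 : r = ∅ → E.card = 1) : (Bouquet.single hE hr hr0).flowers = E \ r := by
  simp [Bouquet.single, Bouquet.flowers]

theorem Bouquet.mem_flowers {B : H.Bouquet} {v : V} :
    v ∈ B.flowers ↔ ∃ E ∈ B.stems, v ∈ E ∧ v ∉ B.roots := by
  simp [Bouquet.flowers]

namespace BouquetSet

theorem mem_flowers {𝓑 : H.BouquetSet} {v : V} :
    v ∈ 𝓑.flowers ↔ ∃ B ∈ 𝓑.carrier, v ∈ B.flowers := by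
  simp [flowers]

theorem mem_roots {𝓑 : H.BouquetSet} {v : V} :
    v ∈ 𝓑.roots ↔ ∃ B ∈ 𝓑.carrier, v ∈ B.roots := by
  simp [roots]

theorem mem_stems {𝓑 : H.BouquetSet} {E : Finset V} :
    E ∈ 𝓑.stems ↔ ∃ B ∈ 𝓑.carrier, E ∈ B.stems := by
  simp [stems]

/-- The bouquet set obtained by adding a bouquet with a new set of stems. -/
noncomputable def adjoin (𝓑 : H.BouquetSet) (B : H.Bouquet) (hB : ∀ B' ∈ 𝓑.carrier,
    B'.stems ≠ B.stems) :
    H.BouquetSet where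
  carrier := by classical exact insert B 𝓑.carrier
  injOn_stems := by
    intro B₁ h₁ B₂ h₂ h
    simp only [Finset.coe_insert, Set.mem_insert_iff, Finset.mem_coe] at h₁ h₂
    rcases h₁ with rfl | h₁ <;> rcases h₂ with rfl | h₂
    · rfl
    · exact absurd h.symm (hB _ h₂)
    · exact absurd h (hB _ h₁)
    · exact 𝓑.injOn_stems h₁ h₂ h

theorem flowers_adjoin (𝓑 : H.BouquetSet) (B : H.Bouquet)
    (hB : ∀ B' ∈ 𝓑.carrier, B'.stems ≠ B.stems) :
    (𝓑.adjoin B hB).flowers = B.flowers ∪ 𝓑.flowers := by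
  simp [flowers, adjoin, Finset.biUnion_insert]

theorem roots_adjoin (𝓑 : H.BouquetSet) (B : H.Bouquet)
    (hB : ∀ B' ∈ 𝓑.carrier, B'.stems ≠ B.stems) :
    (𝓑.adjoin B hB).roots = B.roots ∪ 𝓑.roots := by
  simp [roots, adjoin, Finset.biUnion_insert]

omit [DecidableEq V] in
/-- A set of bouquets with one stem each. -/
theorem exists_of_singles (s : Finset (Finset V)) {P : Finset V → H.Bouquet → Prop}
    (h : ∀ E ∈ s, ∃ B : H.Bouquet, B.stems = {E} ∧ P E B) :
    ∃ 𝓑 : H.BouquetSet, (∀ E ∈ s, ∃ B ∈ 𝓑.carrier, B.stems = {E} ∧ P E B) ∧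
      ∀ B ∈ 𝓑.carrier, ∃ E ∈ s, B.stems = {E} ∧ P E B := by
  classical
  choose B hB using h
  refine ⟨⟨s.attach.image fun E => B E.1 E.2, ?_⟩, fun E hE => ⟨B E hE, ?_, hB E hE⟩, ?_⟩
  · simp only [Set.InjOn, Finset.coe_image, Set.mem_image, Finset.mem_coe]
    rintro _ ⟨⟨E, hE⟩, -, rfl⟩ _ ⟨⟨E', hE'⟩, -, rfl⟩ h
    rw [(hB E hE).1, (hB E' hE').1] at h
    obtain rfl := Finset.singleton_injective h
    rfl
  · exact Finset.mem_image.2 ⟨⟨E, hE⟩, Finset.mem_attach _ _, rfl⟩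
  · intro B' hB'
    obtain ⟨⟨E, hE⟩, -, rfl⟩ := Finset.mem_image.1 hB'
    exact ⟨E, hE, hB E hE⟩

/-- An edge inside the roots lies in the union of the chosen stems, hence is one of them, say `e B`.
It has a vertex that is not a root of `B`, and that vertex cannot be a root of another `B'` since `e
B'` is disjoint from `e B`. -/
theorem IsStronglyDisjoint.isSemiStronglyDisjoint {𝓑 : H.BouquetSet}
    (h : 𝓑.IsStronglyDisjoint) : 𝓑.IsSemiStronglyDisjoint := by
  obtain ⟨e, he, hinj, hsub, hind, hdisj⟩ := h
  intro E hE hER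
  have hmem : ∀ B ∈ 𝓑.carrier, e B ∈ 𝓑.carrier.image e := fun B hB =>
    Finset.mem_image_of_mem e hB
  have h1 : E ∈ 𝓑.carrier.image e := by
    refine hind E hE fun v hv => ?_
    obtain ⟨B, hB, hvB⟩ := mem_roots.1 (hER hv)
    exact Finset.mem_biUnion.2 ⟨e B, hmem B hB, (B.roots_ssubset (he B hB)).subset hvB⟩
  obtain ⟨B, hB, rfl⟩ := Finset.mem_image.1 h1
  obtain ⟨v, hv, hvB⟩ := Finset.exists_of_ssubset (B.roots_ssubset (he B hB))
  obtain ⟨B', hB', hvB'⟩ := mem_roots.1 (hER hv)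
  have hne : e B ≠ e B' := fun h => hvB (hinj hB hB' h ▸ hvB')
  exact Finset.disjoint_left.1 (hdisj _ h1 _ (hmem B' hB') hne) hv
    ((B'.roots_ssubset (he B' hB')).subset hvB')

end BouquetSet

/-! ### Comparison of the numerical invariants -/

section Numbers

variable [Fintype V]

theorem le_dNumber' {𝓑 : H.BouquetSet} (h : 𝓑.IsSemiStronglyDisjoint) :
    𝓑.flowers.card ≤ H.dNumber' :=
  le_csSup ⟨Fintype.card V, by rintro _ ⟨𝓑, -, rfl⟩; exact Finset.card_le_univ _⟩ ⟨𝓑, h, rfl⟩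

theorem le_dNumber {𝓑 : H.BouquetSet} (h : 𝓑.IsStronglyDisjoint) :
    𝓑.flowers.card ≤ H.dNumber :=
  le_csSup ⟨Fintype.card V, by rintro _ ⟨𝓑, -, rfl⟩; exact Finset.card_le_univ _⟩ ⟨𝓑, h, rfl⟩

theorem dNumber_le_dNumber' : H.dNumber ≤ H.dNumber' := by
  refine csSup_le' ?_
  rintro _ ⟨𝓑, h, rfl⟩
  exact le_dNumber' h.isSemiStronglyDisjoint

/-- Each matching edge becomes a bouquet with at most one root, so at most one vertex per edge fails
to be a flower. -/
theorem inducedMatchingNumber_le_dNumber (h0 : ∅ ∉ H.edges) :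
    H.inducedMatchingNumber ≤ H.dNumber := by
  classical
  refine csSup_le' ?_
  rintro _ ⟨M, hM, rfl⟩
  have key : ∀ E ∈ M, ∃ B : H.Bouquet, B.stems = {E} ∧ ∃ x, E ⊆ insert x B.flowers := by
    intro E hE
    have hEH := hM.1 hE
    obtain ⟨x, hx⟩ := Finset.nonempty_iff_ne_empty.2 fun h => h0 (h ▸ hEH)
    by_cases h1 : E.card = 1
    · refine ⟨.single hEH (r := ∅) (Finset.empty_ssubset.2 ⟨x, hx⟩) fun _ => h1, rfl, x, ?_⟩
      rw [Bouquet.flowers_single, Finset.sdiff_empty]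
      exact Finset.subset_insert x E
    · have hxE : ({x} : Finset V) ⊂ E := by
        refine (Finset.singleton_subset_iff.2 hx).ssubset_of_ne ?_
        rintro rfl
        simp at h1
      refine ⟨.single hEH hxE (by simp), rfl, x, ?_⟩
      rw [Bouquet.flowers_single]
      grind
  obtain ⟨𝓑, h1, h2⟩ := BouquetSet.exists_of_singles M key
  have hstem : ∀ {B : H.Bouquet} {E : Finset V}, B.stems = {E} → B.stems.biUnion id = E := by
    intro B E h
    simp [h]
  have hsd : 𝓑.IsStronglyDisjoint := by
    refine ⟨fun B => B.stems.biUnion id, fun B hB => ?_, fun B hB B' hB' h => ?_, ?_⟩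
    · obtain ⟨E, -, hE, -⟩ := h2 B hB
      simp [hE]
    · obtain ⟨E, -, hE, -⟩ := h2 B hB
      obtain ⟨E', -, hE', -⟩ := h2 B' hB'
      have h' : B.stems.biUnion id = B'.stems.biUnion id := h
      rw [hstem hE, hstem hE'] at h'
      exact 𝓑.injOn_stems hB hB' (by rw [hE, hE', h'])
    · convert hM
      ext E
      rw [Finset.mem_image]
      constructor
      · rintro ⟨B, hB, rfl⟩
        obtain ⟨E, hEM, hE, -⟩ := h2 B hB
        rwa [hstem hE]
      · intro hE
        obtain ⟨B, hB, hBE, -⟩ := h1 E hE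
        exact ⟨B, hB, hstem hBE⟩
  refine le_trans ?_ (le_dNumber hsd)
  choose B hB hBE x hx using h1
  have hsub : M.biUnion id ⊆ 𝓑.flowers ∪ M.attach.image fun E => x E.1 E.2 := by
    intro v hv
    obtain ⟨E, hE, hvE⟩ := Finset.mem_biUnion.1 hv
    rcases Finset.mem_insert.1 (hx E hE hvE) with rfl | h
    · exact Finset.mem_union_right _ 
        (Finset.mem_image.2 ⟨⟨E, hE⟩, Finset.mem_attach M _, rfl⟩)
    · exact Finset.mem_union_left _ (BouquetSet.mem_flowers.2 ⟨_, hB E hE, h⟩)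
  have h3 := (Finset.card_le_card hsub).trans (Finset.card_union_le _ _)
  have h4 : (M.attach.image fun E => x E.1 E.2).card ≤ M.card :=
    Finset.card_image_le.trans_eq Finset.card_attach
  omega

theorem IsMinimalVertexCover.card_le_dNumber' {C : Finset V} (hC : H.IsMinimalVertexCover C) :
    C.card ≤ H.dNumber' := by
  obtain ⟨𝓑, h1, h2⟩ := BouquetSet.exists_of_singles (H := H)
    (H.edges.filter fun E => ∃ v ∈ C, v ∈ E ∧ ∀ w ∈ E, w ∈ C → w = v)
    (P := fun E B => B.roots = E \ C) (by
      intro E hE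
      obtain ⟨hEH, v, hvC, hvE, hv⟩ := Finset.mem_filter.1 hE
      refine ⟨.single hEH (r := E \ C) ?_ ?_, rfl, rfl⟩
      · exact Finset.sdiff_subset.ssubset_of_ne fun h => (Finset.mem_sdiff.1 (h ▸ hvE)).2 hvC
      · intro h
        rw [Finset.card_eq_one]
        refine ⟨v, Finset.eq_singleton_iff_unique_mem.2 ⟨hvE, fun w hw => hv w hw ?_⟩⟩
        exact Finset.sdiff_eq_empty_iff_subset.1 h hw)
  have hsd : 𝓑.IsSemiStronglyDisjoint := by
    intro E hE hER
    obtain ⟨v, hvE, hvC⟩ := hC.prop E hE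
    obtain ⟨B, hB, hvB⟩ := BouquetSet.mem_roots.1 (hER hvE)
    obtain ⟨E', -, -, hE'⟩ := h2 B hB
    rw [hE'] at hvB
    exact (Finset.mem_sdiff.1 hvB).2 hvC
  refine (Finset.card_le_card fun v hv => ?_).trans (le_dNumber' hsd)
  obtain ⟨E, hE, hvE, hEv⟩ := hC.exists_edge hv
  obtain ⟨B, hB, hBE, hBr⟩ := h1 E (Finset.mem_filter.2 ⟨hE, v, hv, hvE, hEv⟩)
  refine BouquetSet.mem_flowers.2 ⟨B, hB, Bouquet.mem_flowers.2 ⟨E, by simp [hBE], hvE, ?_⟩⟩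
  simp [hBr, hv]

/-! ### Flowers of a maximal semi-strongly disjoint set -/

namespace BouquetSet

variable {𝓑 : H.BouquetSet}

/-- A bouquet with one stem cannot contribute a new flower to a maximal set of bouquets. -/
theorem not_isIndependent_of_single (hmax : H.dNumber' = 𝓑.flowers.card)
    {E r : Finset V} {x : V} (hE : E ∈ H.edges) (hr : r ⊂ E)
    (hr0 : r = ∅ → E.card = 1) (hxE : x ∈ E) (hxr : x ∉ r) (hxF : x ∉ 𝓑.flowers)
    (hxR : x ∉ 𝓑.roots) : ¬ H.IsIndependent (r ∪ 𝓑.roots) := by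
  intro hind
  -- A bouquet already having `E` as its only stem would make `x` a flower or a root.
  have hnew : ∀ B ∈ 𝓑.carrier, B.stems ≠ (Bouquet.single hE hr hr0).stems := by
    intro B hB h
    have h' : B.stems = {E} := h
    refine hxF (mem_flowers.2 ⟨B, hB, Bouquet.mem_flowers.2 ⟨E, by simp [h'], hxE, fun h => ?_⟩⟩)
    exact hxR (mem_roots.2 ⟨B, hB, h⟩)
  have h1 : (𝓑.adjoin _ hnew).IsSemiStronglyDisjoint := by
    rw [IsSemiStronglyDisjoint, roots_adjoin]
    exact hind
  have h2 := le_dNumber' h1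
  rw [flowers_adjoin, Bouquet.flowers_single, hmax] at h2
  have h3 : insert x 𝓑.flowers ⊆ E \ r ∪ 𝓑.flowers := by grind
  have h4 := Finset.card_le_card h3
  rw [Finset.card_insert_of_notMem hxF] at h4
  omega

theorem isVertexCover_flowers (hdisj : 𝓑.IsSemiStronglyDisjoint)
    (hmax : H.dNumber' = 𝓑.flowers.card) : H.IsVertexCover 𝓑.flowers := by
  intro E hE
  by_contra! hEF
  obtain ⟨x, hxE, hxR⟩ := Finset.not_subset.1 (hdisj E hE)
  -- Taking `E ∩ 𝓑.roots` as roots adds no new root; it is admissible unless it is empty and `E` is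
  -- not a singleton.
  by_cases hr : E ∩ 𝓑.roots = ∅ → E.card = 1
  · refine not_isIndependent_of_single hmax hE (r := E ∩ 𝓑.roots)
      (Finset.inter_subset_left.ssubset_of_ne fun h => hxR ?_) hr hxE (by simp [hxR])
      (hEF x hxE) hxR ?_
    · exact (Finset.mem_inter.1 (h ▸ hxE)).2
    · rw [Finset.union_eq_right.2 Finset.inter_subset_right]
      exact hdisj
  push Not at hr
  obtain ⟨hER, hcard⟩ := hr
  have hdis : ∀ v ∈ E, v ∉ 𝓑.roots := fun v hv hvR => by
    have : v ∈ E ∩ 𝓑.roots := Finset.mem_inter.2 ⟨hv, hvR⟩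
    simp [hER] at this
  obtain ⟨y, hyE, hyx⟩ : ∃ y ∈ E, y ≠ x := by
    by_contra! h
    exact hcard (Finset.card_eq_one.2 ⟨x, Finset.eq_singleton_iff_unique_mem.2 ⟨hxE, h⟩⟩)
  by_cases hy : H.IsIndependent ({y} ∪ 𝓑.roots)
  · refine not_isIndependent_of_single hmax hE (r := {y})
      ((Finset.singleton_subset_iff.2 hyE).ssubset_of_ne fun h => hyx ?_) (by simp) hxE
      (by simpa using hyx.symm) (hEF x hxE) hxR hy
    rw [← h] at hxE
    exact (Finset.mem_singleton.1 hxE).symm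
  · simp only [IsIndependent, not_forall, not_not] at hy
    obtain ⟨E', hE', hsub⟩ := hy
    -- The edge must use `y`, as the roots alone are independent. The bouquet on `E'` with roots
    -- `E'.erase y` then adds the flower `y` and no new root.
    have hyE' : y ∈ E' := by
      by_contra hyE'
      refine hdisj E' hE' fun v hv => ?_
      rcases Finset.mem_union.1 (hsub hv) with h | h
      · exact absurd (Finset.mem_singleton.1 h ▸ hv) hyE'
      · exact h
    refine not_isIndependent_of_single hmax hE' (Finset.erase_ssubset hyE') (fun h => ?_) hyE'
      (Finset.notMem_erase y E') (hEF y hyE) (hdis y hyE) ?_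
    · rw [← Finset.insert_erase hyE', h]
      simp
    · rw [Finset.union_eq_right.2 (by grind)]
      exact hdisj

omit [Fintype V] in
theorem exists_root_of_mem_flowers (h2 : ∀ E ∈ 𝓑.stems, E.card = 2) {v : V}
    (hv : v ∈ 𝓑.flowers) : ∃ z ∈ 𝓑.roots, {v, z} ∈ H.edges := by
  obtain ⟨B, hB, hvB⟩ := mem_flowers.1 hv
  obtain ⟨E, hE, hvE, hvr⟩ := Bouquet.mem_flowers.1 hvB
  have hcard := h2 E (mem_stems.2 ⟨B, hB, hE⟩)
  obtain ⟨z, hz⟩ := B.roots_nonempty hE (by omega)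
  have hsub : {v, z} ⊆ E :=
    Finset.insert_subset hvE (Finset.singleton_subset_iff.2 ((B.roots_ssubset hE).subset hz))
  have hvz : v ≠ z := fun h => hvr (h ▸ hz)
  refine ⟨z, mem_roots.2 ⟨B, hB, hz⟩, ?_⟩
  rw [Finset.eq_of_subset_of_card_le hsub (by rw [hcard, Finset.card_pair hvz])]
  exact B.stems_subset hE

/-- The edge joining `v` to a root `z` is private to `v`: if `z` were also a flower, it would be
joined to another root, giving an edge inside the independent set of roots. -/
theorem isMinimalVertexCover_flowers (hdisj : 𝓑.IsSemiStronglyDisjoint)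
    (hmax : H.dNumber' = 𝓑.flowers.card) (h2 : ∀ E ∈ 𝓑.stems, E.card = 2) :
    H.IsMinimalVertexCover 𝓑.flowers := by
  refine (isVertexCover_flowers hdisj hmax).isMinimalVertexCover fun v hv => ?_
  obtain ⟨z, hz, hE⟩ := exists_root_of_mem_flowers h2 hv
  refine ⟨_, hE, fun w hw hwF => ?_⟩
  rcases Finset.mem_insert.1 hw with rfl | hw
  · rfl
  · rw [Finset.mem_singleton] at hw
    subst hw
    obtain ⟨z', hz', hE'⟩ := exists_root_of_mem_flowers h2 hwF
    exact absurd (Finset.insert_subset hz (Finset.singleton_subset_iff.2 hz')) (hdisj _ hE')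

end BouquetSet

end Numbers

end SimpleHypergraph

/-! ### The edge ideal, its minimal primes and its projective dimension -/

namespace SimpleHypergraph

variable {V : Type u} (k : Type w) [Field k]

theorem edgeIdeal_eq_nonfaceIdeal (H : SimpleHypergraph V) :
    H.edgeIdeal k = H.independenceComplex.nonfaceIdeal k := by
  classical
  have himage : {f : MvPolynomial V k | ∃ E ∈ H.edges, f = ∏ x ∈ E, MvPolynomial.X x} =
      (fun m => MvPolynomial.monomial m (1 : k)) ''
        {m | ∃ E ∈ H.edges, m = ∑ x ∈ E, Finsupp.single x 1} := by
    ext f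
    constructor
    · rintro ⟨E, hE, rfl⟩
      exact ⟨_, ⟨E, hE, rfl⟩, MvPolynomial.monomial_sum_one _ _⟩
    · rintro ⟨_, ⟨E, hE, rfl⟩, rfl⟩
      exact ⟨E, hE, MvPolynomial.monomial_sum_one _ _⟩
  have hle : ∀ (E : Finset V) (m : V →₀ ℕ),
      ∑ x ∈ E, Finsupp.single x 1 ≤ m ↔ E ⊆ m.support := by
    intro E m
    have hval : ∀ v, (∑ x ∈ E, Finsupp.single x 1 : V →₀ ℕ) v = if v ∈ E then 1 else 0 := by
      intro v
      simp [Finsupp.finsetSum_apply, Finsupp.single_apply]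
    rw [Finsupp.le_def]
    refine forall_congr' fun v => ?_
    rw [hval, Finsupp.mem_support_iff]
    by_cases hv : v ∈ E <;> simp [hv, Nat.one_le_iff_ne_zero]
  ext f
  rw [edgeIdeal, himage, MvPolynomial.mem_ideal_span_monomial_image,
    FaceComplex.mem_nonfaceIdeal]
  refine forall₂_congr fun m _ => ?_
  simp [independenceComplex, IsIndependent, hle]

variable {k} {H : SimpleHypergraph V}

/-- A prime `Q` between the edge ideal and this one contains a variable of the private edge of `v`;
that variable lies in `C`, so it is `X v`. -/
theorem nonfaceIdeal_avoiding_mem_minimalPrimes {C : Finset V} (hC : H.IsMinimalVertexCover C) :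
    (FaceComplex.avoiding C).nonfaceIdeal k ∈ (H.edgeIdeal k).minimalPrimes := by
  classical
  refine ⟨⟨FaceComplex.nonfaceIdeal_avoiding_isPrime k C, Ideal.span_le.2 ?_⟩, ?_⟩
  · rintro _ ⟨E, hE, rfl⟩
    obtain ⟨v, hv, hvC⟩ := hC.prop E hE
    exact Ideal.mem_of_dvd _ (Finset.dvd_prod_of_mem _ hv)
      ((FaceComplex.X_mem_nonfaceIdeal_avoiding k).2 hvC)
  · rintro Q ⟨hQ, hIQ⟩ hle
    rw [FaceComplex.nonfaceIdeal_avoiding, Ideal.span_le]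
    rintro _ ⟨v, hv, rfl⟩
    obtain ⟨E, hE, hvE, hEv⟩ := hC.exists_edge hv
    obtain ⟨w, hw, hwQ⟩ := hQ.prod_mem_iff.1 (hIQ (Ideal.subset_span ⟨E, hE, rfl⟩))
    have hwC := (FaceComplex.X_mem_nonfaceIdeal_avoiding k).1 (hle hwQ)
    exact hEv w hw hwC ▸ hwQ

theorem IsMinimalVertexCover.card_le_bigheight {C : Finset V} (hC : H.IsMinimalVertexCover C) :
    (C.card : ℕ∞) ≤ (H.edgeIdeal k).bigheight :=
  (FaceComplex.le_height_nonfaceIdeal_avoiding k C).trans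
    (le_iSup₂ (f := fun p (_ : p ∈ (H.edgeIdeal k).minimalPrimes) => p.height) _
      (nonfaceIdeal_avoiding_mem_minimalPrimes hC))

/-- The vertices whose variables lie in `p` form a cover; a minimal cover inside it generates a
prime below `p`, equal to `p` by minimality. -/
theorem exists_of_mem_minimalPrimes [Fintype V] {p : Ideal (MvPolynomial V k)}
    (hp : p ∈ (H.edgeIdeal k).minimalPrimes) :
    ∃ C, H.IsMinimalVertexCover C ∧ p = (FaceComplex.avoiding C).nonfaceIdeal k := by
  classical
  have hprime := hp.1.1
  have hcover : H.IsVertexCover (Finset.univ.filter fun v => MvPolynomial.X v ∈ p) := by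
    intro E hE
    obtain ⟨w, hw, hwp⟩ := hprime.prod_mem_iff.1 (hp.1.2 (Ideal.subset_span ⟨E, hE, rfl⟩))
    exact ⟨w, hw, by simpa using hwp⟩
  obtain ⟨C, hC, hCp⟩ := hcover.exists_isMinimalVertexCover
  have hle : (FaceComplex.avoiding C).nonfaceIdeal k ≤ p := by
    rw [FaceComplex.nonfaceIdeal_avoiding, Ideal.span_le]
    rintro _ ⟨v, hv, rfl⟩
    simpa using hCp hv
  exact ⟨C, hC, le_antisymm
    (hp.2 (nonfaceIdeal_avoiding_mem_minimalPrimes (k := k) hC).1 hle) hle⟩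

variable [Fintype V] [DecidableEq V]

theorem bigheight_edgeIdeal_le_dNumber' : (H.edgeIdeal k).bigheight ≤ H.dNumber' := by
  refine iSup₂_le fun p hp => ?_
  obtain ⟨C, hC, rfl⟩ := exists_of_mem_minimalPrimes hp
  rw [FaceComplex.height_nonfaceIdeal_avoiding]
  exact_mod_cast hC.card_le_dNumber'

theorem IsMinimalVertexCover.card_le_projectiveDimension {C : Finset V}
    (hC : H.IsMinimalVertexCover C) :
    (C.card : WithBot ℕ∞) ≤ projectiveDimension
      (ModuleCat.of (MvPolynomial V k) (MvPolynomial V k ⧸ H.edgeIdeal k)) := by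
  rw [projectiveDimension_ge_iff, edgeIdeal_eq_nonfaceIdeal]
  exact FaceComplex.not_hasProjectiveDimensionLT hC.disjoint_iff

theorem IsVertexDecomposable.projectiveDimension_le_dNumber' (hH : H.IsVertexDecomposable) :
    projectiveDimension (ModuleCat.of (MvPolynomial V k)
      (MvPolynomial V k ⧸ H.edgeIdeal k)) ≤ (H.dNumber' : WithBot ℕ∞) := by
  rw [projectiveDimension_le_iff, edgeIdeal_eq_nonfaceIdeal]
  have h := FaceComplex.VertexDecomposable.hasProjectiveDimensionLT k hH
    (fun F _ => Finset.subset_univ F) (H.dNumber' + 1) fun F hF => by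
      rw [← Finset.compl_eq_univ_sdiff]
      exact Nat.lt_succ_of_le (isMinimalVertexCover_compl hF).card_le_dNumber'
  have hext : H.independenceComplex.extend Finset.univ = H.independenceComplex := by
    ext F
    simp [FaceComplex.extend]
  rwa [hext] at h

end SimpleHypergraph

end StanleyReisner

theorem mainTheorem9 {V : Type u} [Fintype V] [DecidableEq V] {k : Type w} [Field k]
    (H : SimpleHypergraph V) (𝓑 : H.BouquetSet) (hdisj : 𝓑.IsSemiStronglyDisjoint)
    (hmax : H.dNumber' = 𝓑.flowers.card) :
    (∃ C, H.IsMinimalVertexCover C ∧ C ⊆ 𝓑.flowers) ∧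
    ((∀ E ∈ 𝓑.stems, E.card = 2) →
      H.IsMinimalVertexCover 𝓑.flowers ∧
      H.inducedMatchingNumber ≤ H.dNumber ∧
      H.dNumber ≤ H.dNumber' ∧
      (H.dNumber' : ℕ∞) ≤ (H.edgeIdeal k).bigheight ∧
      ((H.edgeIdeal k).bigheight : WithBot ℕ∞) ≤
        CategoryTheory.projectiveDimension
          (ModuleCat.of (MvPolynomial V k) (MvPolynomial V k ⧸ H.edgeIdeal k))) ∧
    (H.IsVertexDecomposable → (∀ E ∈ 𝓑.stems, E.card = 2) →
      ((H.edgeIdeal k).bigheight : WithBot ℕ∞) =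
        CategoryTheory.projectiveDimension
          (ModuleCat.of (MvPolynomial V k) (MvPolynomial V k ⧸ H.edgeIdeal k)) ∧
      CategoryTheory.projectiveDimension
          (ModuleCat.of (MvPolynomial V k) (MvPolynomial V k ⧸ H.edgeIdeal k)) =
        ((H.dNumber' : ℕ∞) : WithBot ℕ∞)) := by
  have hcover := SimpleHypergraph.BouquetSet.isVertexCover_flowers hdisj hmax
  have hpair : (∀ E ∈ 𝓑.stems, E.card = 2) → H.IsMinimalVertexCover 𝓑.flowers ∧
      (H.edgeIdeal k).bigheight = H.dNumber' ∧ ((H.dNumber' : ℕ∞) : WithBot ℕ∞) ≤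
        CategoryTheory.projectiveDimension
          (ModuleCat.of (MvPolynomial V k) (MvPolynomial V k ⧸ H.edgeIdeal k)) := by
    intro h2
    have hmin := SimpleHypergraph.BouquetSet.isMinimalVertexCover_flowers hdisj hmax h2
    refine ⟨hmin, le_antisymm SimpleHypergraph.bigheight_edgeIdeal_le_dNumber' ?_, ?_⟩
    · rw [hmax]
      exact hmin.card_le_bigheight
    · rw [hmax]
      exact hmin.card_le_projectiveDimension
  refine ⟨hcover.exists_isMinimalVertexCover, fun h2 => ?_, fun hvd h2 => ?_⟩
  · obtain ⟨hmin, hbig, hpd⟩ := hpair h2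
    refine ⟨hmin, SimpleHypergraph.inducedMatchingNumber_le_dNumber fun h0 => ?_,
      SimpleHypergraph.dNumber_le_dNumber', hbig.ge, by rwa [hbig]⟩
    -- An empty edge would lie inside the independent set of roots.
    exact hdisj ∅ h0 (Finset.empty_subset _)
  · obtain ⟨-, hbig, hpd⟩ := hpair h2
    have heq := le_antisymm (hvd.projectiveDimension_le_dNumber' (k := k)) hpd
    exact ⟨by rw [hbig]; exact heq.symm, heq⟩
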